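/- Fix an algebraic closure $\overline{\mathbb{Q}}$ of $\mathbb{Q}$. Say that a field $F$ has property (P) if there is no infinite subset $X\subseteq F$ with $f(X)=X$ for some polynomial $f\in F[x]$ of degree at least $2$, and that $F$ satisfies (P2) if every polynomial $f\in F[x]$ of degree at least $2$ has only finitely many periodic points in $F$, i.e. only finitely many $\alpha\in F$ such that $f^m(\alpha)=\alpha$ for some $m\geq 1$, where $f^m$ denotes the $m$-th iterate of $f$. Let $(p_n)_{n\geq 1}$ be a sequence of pairwise distinct prime numbers, and let $K_0\subseteq K_1\subseteq K_2\subseteq\cdots$ be number fields in $\overline{\mathbb{Q}}$ such that, for every $n\geq 1$, the extension $K_n/K_{n-1}$ is totally ramified at all primes of $K_{n-1}$ lying above $p_1,\ldots,p_n$; that is, for every $i \in\{1,\ldots,n\}$, every prime ideal $\mathfrak{p}$ of $\mathcal{O}_{K_{n-1}}$ above $p_i$ and every prime ideal $\mathfrak{P}$ of $\mathcal{O}_{K_n}$ above $\mathfrak{p}$, the ramification index of $\mathfrak{P}$ over $\mathfrak{p}$ is $[K_n:K_{n-1}]$. Then the field $F=\bigcup_{n\geq 0}K_n$ satisfies (P2).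 If in addition $[K_n:K_{n-1}]=p_n$ for all $n\geq 1$, then $F$ has property (P). -/

import Mathlib

open scoped NumberField

/-- Narkiewicz's property (P) of a field `F`: no polynomial `f` over `F` of degree at least two
admits an infinite set `X ⊆ F` with `f(X) = X`. -/
def PropertyP (F : Type*) [Field F] : Prop :=
  ∀ f : Polynomial F, 2 ≤ f.natDegree →
    ¬ ∃ X : Set F, X.Infinite ∧ (fun x : F => f.eval x) '' X = X

/-- Property (P2) of a field `F`: every polynomial over `F` of degree at least two has only
finitely many periodic points in `F`. -/
def PropertyP2 (F : Type*) [Field F] : Prop :=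
  ∀ f : Polynomial F, 2 ≤ f.natDegree →
    (Function.periodicPts (fun x : F => f.eval x)).Finite

/-- The extension `L/K` is totally ramified at the prime `𝔭` of `𝓞 K`: every prime `𝔓` of `𝓞 L`
above `𝔭` has ramification index `[L : K]` over `𝔭` (so that there is exactly one such `𝔓`). -/
def IsTotallyRamifiedAt (K L : Type*) [Field K] [Field L] [Algebra K L]
    (𝔭 : Ideal (𝓞 K)) : Prop :=
  ∀ 𝔓 : Ideal (𝓞 L), 𝔓.IsPrime → 𝔓.LiesOver 𝔭 →
    𝔓.ramificationIdx (𝓞 K) = Module.finrank K L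

/-- The extension `L/K` is totally ramified at every prime of `𝓞 K` (non-archimedean valuation
of `K`) lying above the rational prime `p`. -/
def IsTotallyRamifiedAbove (K L : Type*) [Field K] [Field L] [Algebra K L] (p : ℕ) : Prop :=
  ∀ 𝔭 : Ideal (𝓞 K), 𝔭.IsPrime → 𝔭.LiesOver (Ideal.span {(p : ℤ)}) →
    IsTotallyRamifiedAt K L 𝔭

/-! For (P2), take `f` over `F` of degree at least 2. At all but finitely many of the `p i` it has
good reduction, and since `p i` is totally ramified from some level on, `F` has a finite residue
field above `p i` (`finite_quotient_of_isTotallyRamifiedAbove`). Periodic points are then integral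
at that place. If the residue field has `q` elements, iterating `q! * (q - 1)` times makes a
periodic point fixed modulo the maximal ideal with multiplier 0 or 1; Taylor expansion along the
orbit shows that what remains of the period is a power of `p i`
(`exists_iterate_eq_of_mem_periodicPts`). So every period divides a constant times a power of `p i`.
Two such primes together bound all periods (`finite_periodicPts_of_period_bounds`).

For (P), suppose `f(X) = X` with `X` infinite. By (P2) some point of `X` is not periodic; it starts
a backward orbit in `X`. Once the prime degrees exceed `deg f`, preimages cannot leave a fixed `K m`
(`mem_of_eval_mem_of_prime_degrees`). There the orbit has bounded height, hence is finite
(`finite_range_of_backward_orbit`), so it repeats and its starting point is periodic, a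
contradiction. -/

open Polynomial

/-! ### Periods of polynomials modulo a maximal ideal with finite residue field -/

section Dynamics

variable {R : Type*} [CommRing R]

/-- Chain rule along an orbit that stays in one residue class: if `x` is fixed by `f` modulo `M`,
then the iterates of `f` fix `x` modulo `M`, and their multipliers are the powers of the
multiplier of `f`. -/
lemma mk_derivative_iterate_comp (M : Ideal R) (f : R[X]) (x : R)
    (hx : Ideal.Quotient.mk M (f.eval x) = Ideal.Quotient.mk M x) (n : ℕ) :
    Ideal.Quotient.mk M ((f.comp^[n] X).eval x) = Ideal.Quotient.mk M x ∧
      Ideal.Quotient.mk M ((derivative (f.comp^[n] X)).eval x) =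
        Ideal.Quotient.mk M (f.derivative.eval x) ^ n := by
  have key : ∀ (g : R[X]) (y : R), Ideal.Quotient.mk M y = Ideal.Quotient.mk M x →
      Ideal.Quotient.mk M (g.eval y) = Ideal.Quotient.mk M (g.eval x) := by
    intro g y hy
    rw [← eval_map_apply, ← eval_map_apply, hy]
  induction n with
  | zero => simp
  | succ n ih =>
    rw [Function.iterate_succ_apply']
    refine ⟨?_, ?_⟩
    · rw [eval_comp, key _ _ ih.1, hx]
    · rw [derivative_comp, eval_mul, eval_comp, map_mul, ih.2, key _ _ ih.1, pow_succ]

/-- The successive differences along an orbit of `f` that stays in one residue class. -/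
lemma exists_iterate_succ_sub_iterate (M : Ideal R) (f : R[X]) (x : R)
    (hx : Ideal.Quotient.mk M (f.eval x) = Ideal.Quotient.mk M x) (n : ℕ) :
    ∃ u : R, Ideal.Quotient.mk M u = Ideal.Quotient.mk M (f.derivative.eval x) ^ n ∧
      (fun y => f.eval y)^[n + 1] x - (fun y => f.eval y)^[n] x = (f.eval x - x) * u := by
  induction n with
  | zero => exact ⟨1, by simp, by simp⟩
  | succ n ih =>
    obtain ⟨u, hu, hd⟩ := ih
    set a := (fun y => f.eval y)^[n] x with ha
    have hax : Ideal.Quotient.mk M a = Ideal.Quotient.mk M x := by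
      have := (mk_derivative_iterate_comp M f x hx n).1
      rwa [iterate_comp_eval, eval_X] at this
    have h0 : Ideal.Quotient.mk M (f.eval x - x) = 0 := by rw [map_sub, hx, sub_self]
    -- Second-order Taylor expansion at `a`, the increment being the previous difference. The
    -- increment vanishes modulo `M`, so the new factor is `f'(x)` there.
    obtain ⟨k, hk⟩ := f.binomExpansion a ((f.eval x - x) * u)
    refine ⟨u * (f.derivative.eval a + k * ((f.eval x - x) * u)), ?_, ?_⟩
    · rw [map_mul, map_add, map_mul, map_mul, h0, hu, zero_mul, mul_zero, add_zero,
        pow_succ, ← eval_map_apply (x := a), hax, eval_map_apply]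
    · rw [Function.iterate_succ_apply' _ (n + 1), Function.iterate_succ_apply' _ n] at *
      rw [← ha] at hd ⊢
      have e : f.eval a = a + (f.eval x - x) * u := by rw [← hd]; ring
      rw [e, hk, e]
      ring

variable [IsDomain R]

/-- A periodic point that is fixed modulo `M` with multiplier in `M` is fixed. -/
lemma eval_eq_of_multiplier_zero (M : Ideal R) (hM : M ≠ ⊤) (f : R[X]) (x : R)
    (hx : Ideal.Quotient.mk M (f.eval x) = Ideal.Quotient.mk M x)
    (h0 : Ideal.Quotient.mk M (f.derivative.eval x) = 0) {n : ℕ} (hn : 0 < n)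
    (hper : (fun y => f.eval y)^[n] x = x) : f.eval x = x := by
  obtain ⟨u, hu, hd⟩ := exists_iterate_succ_sub_iterate M f x hx n
  rw [Function.iterate_succ_apply', hper] at hd
  have h : (f.eval x - x) * (1 - u) = 0 := by
    rw [mul_sub, ← hd]; ring
  rcases mul_eq_zero.1 h with h | h
  · exact sub_eq_zero.1 h
  · rw [← sub_eq_zero.1 h, h0, zero_pow hn.ne', map_one] at hu
    exact absurd (Ideal.Quotient.subsingleton_iff.1 (subsingleton_of_zero_eq_one hu.symm)) hM

/-- A periodic point that is fixed modulo `M` with multiplier one modulo `M`, of period prime to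
the residue characteristic, is fixed. -/
lemma eval_eq_of_multiplier_one (M : Ideal R) (hM : M ≠ ⊤) {p : ℕ} (hpM : (p : R) ∈ M)
    (f : R[X]) (x : R)
    (hx : Ideal.Quotient.mk M (f.eval x) = Ideal.Quotient.mk M x)
    (h1 : Ideal.Quotient.mk M (f.derivative.eval x) = 1) {n : ℕ} (hn : n.Coprime p)
    (hper : (fun y => f.eval y)^[n] x = x) : f.eval x = x := by
  -- Telescoping: with multiplier one, each of the `k` successive differences contributes a factor
  -- congruent to 1.
  have H : ∀ k : ℕ, ∃ u : R, Ideal.Quotient.mk M u = k ∧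
      (fun y => f.eval y)^[k] x - x = (f.eval x - x) * u := by
    intro k
    induction k with
    | zero => exact ⟨0, by simp, by simp⟩
    | succ k ih =>
      obtain ⟨u, hu, hd⟩ := ih
      obtain ⟨v, hv, he⟩ := exists_iterate_succ_sub_iterate M f x hx k
      refine ⟨u + v, ?_, ?_⟩
      · rw [map_add, hu, hv, h1, one_pow]; push_cast; ring
      · rw [mul_add, ← hd, ← he]; ring
  obtain ⟨u, hu, hd⟩ := H n
  rw [hper, sub_self] at hd
  rcases mul_eq_zero.1 hd.symm with h | h
  · exact sub_eq_zero.1 h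
  · rw [h, map_zero] at hu
    have hnM : (n : R) ∈ M := by
      rw [← Ideal.Quotient.eq_zero_iff_mem, map_natCast, ← hu]
    have hco : IsCoprime (n : R) (p : R) := by
      simpa using (Nat.isCoprime_iff_coprime.2 hn).map (Int.castRingHom R)
    obtain ⟨a, b, hab⟩ := hco
    exact absurd (M.eq_top_iff_one.2 (hab ▸ M.add_mem (M.mul_mem_left _ hnM)
      (M.mul_mem_left _ hpM))) hM

/-- Over a domain `R` with a maximal ideal `M` of finite residue field of characteristic `p`,
periods of periodic points of polynomials are bounded up to powers of `p`. -/
theorem exists_iterate_eq_of_mem_periodicPts (M : Ideal R) [hM : M.IsMaximal] [Finite (R ⧸ M)]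
    {p : ℕ} (hp : p.Prime) (hpM : (p : R) ∈ M) (f : R[X]) (x : R)
    (hx : x ∈ Function.periodicPts (fun y => f.eval y)) :
    ∃ e : ℕ, (fun y => f.eval y)^[(Nat.card (R ⧸ M)).factorial * (Nat.card (R ⧸ M) - 1) * p ^ e] x
      = x := by
  set q := Nat.card (R ⧸ M) with hq
  obtain ⟨N, hN, hNx⟩ := hx
  have hNx' : (fun y => f.eval y)^[N] x = x := hNx
  set fb := f.map (Ideal.Quotient.mk M)
  have hsemi : Function.Semiconj (Ideal.Quotient.mk M) (fun y => f.eval y) (fun y => fb.eval y) :=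
    fun y => (eval_map_apply (f := Ideal.Quotient.mk M) (p := f) y).symm
  have hperb : Function.IsPeriodicPt (fun y => fb.eval y) N (Ideal.Quotient.mk M x) :=
    hNx.map hsemi
  have hle : Function.minimalPeriod (fun y => fb.eval y) (Ideal.Quotient.mk M x) ≤ q := by
    have := Fintype.ofFinite (R ⧸ M)
    rw [hq, Nat.card_eq_fintype_card]
    exact Function.minimalPeriod_le_card
  have hpos := hperb.minimalPeriod_pos hN
  -- The reduced period is at most `q`, so `q!` is a multiple of it that does not depend on `x`.
  have hperq : Function.IsPeriodicPt (fun y => fb.eval y) q.factorial (Ideal.Quotient.mk M x) :=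
    (Function.isPeriodicPt_minimalPeriod _ _).trans_dvd (Nat.dvd_factorial hpos hle)
  have hevalit : ∀ (g : R[X]) (n : ℕ) (y : R), (g.comp^[n] X).eval y = (fun y => g.eval y)^[n] y := by
    intro g n y; rw [iterate_comp_eval, eval_X]
  have hfun : ∀ (g : R[X]) (n : ℕ), (fun y => (g.comp^[n] X).eval y) = (fun y => g.eval y)^[n] := by
    intro g n; ext y; exact hevalit g n y
  set g := f.comp^[q.factorial] X with hg
  have hgx : Ideal.Quotient.mk M (g.eval x) = Ideal.Quotient.mk M x := by
    rw [hg, hevalit, (hsemi.iterate_right _).eq]; exact hperq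
  -- The multiplier of `h` is a `(q - 1)`-th power in a field of `q` elements, hence 0 or 1.
  set h := g.comp^[q - 1] X with hh
  have hhx := (mk_derivative_iterate_comp M g x hgx (q - 1))
  have hhN : ∀ n, (fun y => h.eval y)^[n] = (fun y => f.eval y)^[q.factorial * (q - 1) * n] := by
    intro n
    rw [hh, hfun, hg, hfun, ← Function.iterate_mul, ← Function.iterate_mul, mul_assoc]
  have hhper : ∀ n, N ∣ n → (fun y => h.eval y)^[n] x = x := by
    intro n hn
    rw [hhN]
    exact (Function.IsPeriodicPt.trans_dvd hNx (hn.mul_left _))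
  have hq1 : 1 < q := by
    have : Nontrivial (R ⧸ M) := Ideal.Quotient.nontrivial_iff.2 hM.ne_top
    exact Finite.one_lt_card
  let : Field (R ⧸ M) := Ideal.Quotient.field M
  by_cases h0 : Ideal.Quotient.mk M (g.derivative.eval x) = 0
  · refine ⟨0, ?_⟩
    rw [← hhN, pow_zero, Function.iterate_one]
    refine eval_eq_of_multiplier_zero M hM.ne_top h x hhx.1 ?_ hN (hhper N dvd_rfl)
    rw [hhx.2, h0, zero_pow (by omega)]
  -- Absorb the `p`-part of the period into the iterate: `h^[p ^ e]` still has multiplier one, and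
  -- `x` returns under it after `s` steps, with `s` prime to `p`.
  · obtain ⟨e, s, hs, rfl⟩ := Nat.exists_eq_pow_mul_and_not_dvd hN.ne' p hp.ne_one
    refine ⟨e, ?_⟩
    have hm1 : Ideal.Quotient.mk M (h.derivative.eval x) = 1 := by
      rw [hhx.2]
      have := Fintype.ofFinite (R ⧸ M)
      rw [hq, Nat.card_eq_fintype_card]
      exact FiniteField.pow_card_sub_one_eq_one _ h0
    have hk := mk_derivative_iterate_comp M h x hhx.1 (p ^ e)
    have := eval_eq_of_multiplier_one M hM.ne_top hpM (h.comp^[p ^ e] X) x hk.1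
      (by rw [hk.2, hm1, one_pow]) (n := s) ((hp.coprime_iff_not_dvd.2 hs).symm)
      (by rw [hfun, ← Function.iterate_mul]; exact hhper _ dvd_rfl)
    rwa [hevalit, hhN] at this

end Dynamics

/-! ### Residue fields in totally ramified towers -/

section Residue

/-- At a totally ramified prime the residue field does not grow. -/
theorem IsTotallyRamifiedAbove.exists_sub_algebraMap_mem {K L : Type*} [Field K] [Field L]
    [NumberField K] [NumberField L] [Algebra K L] {p : ℕ} (hp : p.Prime)
    (h : IsTotallyRamifiedAbove K L p) (P : Ideal (𝓞 L)) [P.IsPrime] (hpP : (p : 𝓞 L) ∈ P)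
    (a : 𝓞 L) : ∃ b : 𝓞 K, a - algebraMap (𝓞 K) (𝓞 L) b ∈ P := by
  set P₀ : Ideal (𝓞 K) := P.under (𝓞 K) with hP₀
  have hp0 : (Ideal.span {(p : ℤ)}).IsMaximal :=
    PrincipalIdealRing.isMaximal_of_irreducible (Nat.prime_iff_prime_int.1 hp).irreducible
  have hunder : P₀.under ℤ = Ideal.span {(p : ℤ)} := by
    refine (hp0.eq_of_le (Ideal.IsPrime.under ℤ P₀).ne_top ?_).symm
    rw [Ideal.span_singleton_le_iff_mem, hP₀]
    simpa [Ideal.mem_comap] using hpP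
  have hlies : P₀.LiesOver (Ideal.span {(p : ℤ)}) := ⟨hunder.symm⟩
  have hmax₀ : P₀.IsMaximal :=
    Ideal.isMaximal_of_isIntegral_of_isMaximal_comap (R := ℤ) P₀
      (by rw [← hunder] at hp0; exact hp0)
  have hmax : P.IsMaximal :=
    Ideal.isMaximal_of_isIntegral_of_isMaximal_comap (R := 𝓞 K) P hmax₀
  have hover : P.LiesOver P₀ := ⟨rfl⟩
  have he := h P₀ hmax₀.isPrime hlies P hmax.isPrime hover
  have : Fintype (P₀.primesOver (𝓞 L)) := (Algebra.QuasiFinite.finite_primesOver P₀).fintype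
  have hsum := Ideal.sum_ramification_inertia_eq_finrank P₀ (𝓞 L)
  -- One term of `∑ e f = [L : K]`; as `e = [L : K]` already, the inertia degree must be 1.
  have hle : P.ramificationIdx (𝓞 K) * P.inertiaDeg (𝓞 K) ≤ Module.finrank K L := by
    rw [IsFractionRing.finrank_eq (𝓞 K) K (𝓞 L) L, ← hsum]
    exact Finset.single_le_sum
      (f := fun q : P₀.primesOver (𝓞 L) => q.1.ramificationIdx (𝓞 K) * q.1.inertiaDeg (𝓞 K))
      (fun _ _ => Nat.zero_le _) (Finset.mem_univ ⟨P, hmax.isPrime, hover⟩)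
  rw [he] at hle
  have hpos : 0 < Module.finrank K L := Module.finrank_pos
  have hf0 : 0 < P.inertiaDeg (𝓞 K) := P.inertiaDeg_pos (𝓞 K)
  have hf : P.inertiaDeg (𝓞 K) = 1 := by nlinarith
  rw [Ideal.inertiaDeg_eq_of_isMaximal P₀ P] at hf
  let : Field (𝓞 K ⧸ P₀) := Ideal.Quotient.field P₀
  obtain ⟨c, hc⟩ := (finrank_eq_one_iff_of_nonzero' (1 : 𝓞 L ⧸ P) one_ne_zero).1 hf
    (Ideal.Quotient.mk P a)
  obtain ⟨b, rfl⟩ := Ideal.Quotient.mk_surjective c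
  refine ⟨b, ?_⟩
  rw [← Ideal.Quotient.eq_zero_iff_mem, map_sub, ← hc, Algebra.smul_def, mul_one]
  exact sub_self _

/-- The ring of integers of a union of a tower of number fields, each totally ramified over the
previous one above `p`, has finite residue fields above `p`. -/
theorem finite_quotient_of_isTotallyRamifiedAbove {Ω : Type*} [Field Ω] (K : ℕ → Subfield Ω)
    [∀ n, NumberField (K n)] (hK : Monotone K) {p : ℕ} (hp : p.Prime) (m : ℕ)
    (hram : ∀ n, m ≤ n →
      letI : Algebra (K n) (K (n + 1)) := (Subfield.inclusion (hK (Nat.le_succ n))).toAlgebra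
      IsTotallyRamifiedAbove (K n) (K (n + 1)) p)
    (F : Subfield Ω) (hF : (F : Set Ω) = ⋃ n, (K n : Set Ω))
    (Q : Ideal (𝓞 F)) [Q.IsPrime] (hpQ : (p : 𝓞 F) ∈ Q) : Finite (𝓞 F ⧸ Q) := by
  have hKF : ∀ n, K n ≤ F := fun n x hx => by
    rw [← SetLike.mem_coe, hF]; exact Set.mem_iUnion.2 ⟨n, hx⟩
  let ι : ∀ n, 𝓞 (K n) →+* 𝓞 F := fun n =>
    NumberField.RingOfIntegers.mapRingHom (Subfield.inclusion (hKF n))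
  have hdescend : ∀ d, ∀ a : 𝓞 (K (m + d)), ∃ b : 𝓞 (K m), ι _ a - ι m b ∈ Q := by
    intro d
    induction d with
    | zero => exact fun a => ⟨a, by simp⟩
    | succ d ih =>
      intro a
      let : Algebra (K (m + d)) (K (m + d + 1)) :=
        (Subfield.inclusion (hK (Nat.le_succ (m + d)))).toAlgebra
      obtain ⟨b, hb⟩ := IsTotallyRamifiedAbove.exists_sub_algebraMap_mem hp
        (hram (m + d) (Nat.le_add_right _ _)) (Q.comap (ι (m + d + 1)))
        (by simpa [Ideal.mem_comap] using hpQ) a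
      obtain ⟨c, hc⟩ := ih b
      refine ⟨c, ?_⟩
      have hcomp : ι (m + d + 1) (algebraMap _ _ b) = ι (m + d) b := rfl
      rw [Ideal.mem_comap, map_sub, hcomp] at hb
      have := Q.add_mem hb hc
      rwa [sub_add_sub_cancel] at this
  have hsurj : Function.Surjective ((Ideal.Quotient.mk Q).comp (ι m)) := by
    intro y
    obtain ⟨a, rfl⟩ := Ideal.Quotient.mk_surjective y
    have ha : ((a : F) : Ω) ∈ (F : Set Ω) := (a : F).2
    rw [hF] at ha
    obtain ⟨n, hn⟩ := Set.mem_iUnion.1 ha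
    have hn' : ((a : F) : Ω) ∈ K (m + n) := hK (Nat.le_add_left n m) hn
    have hint : IsIntegral ℤ (⟨_, hn'⟩ : K (m + n)) := by
      have h1 : IsIntegral ℤ ((a : F) : Ω) :=
        map_isIntegral_int F.subtype (NumberField.RingOfIntegers.isIntegral_coe a)
      exact (isIntegral_algHom_iff (K (m + n)).subtype.toIntAlgHom
        (K (m + n)).subtype_injective).1 h1
    obtain ⟨b, hb⟩ := hdescend n ⟨_, hint⟩
    refine ⟨b, ?_⟩
    rw [RingHom.comp_apply]
    exact (Ideal.Quotient.eq.2 hb).symm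
  -- The kernel contains `p`, and a nonzero ideal of `𝓞 (K m)` has finite quotient.
  have hne : RingHom.ker ((Ideal.Quotient.mk Q).comp (ι m)) ≠ ⊥ := by
    intro h0
    have : (p : 𝓞 (K m)) ∈ RingHom.ker ((Ideal.Quotient.mk Q).comp (ι m)) := by
      rw [RingHom.mem_ker, map_natCast, ← map_natCast (Ideal.Quotient.mk Q)]
      exact Ideal.Quotient.eq_zero_iff_mem.2 hpQ
    rw [h0, Ideal.mem_bot] at this
    exact hp.ne_zero (by exact_mod_cast this)
  have := Ideal.finiteQuotientOfFreeOfNeBot _ hne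
  exact Finite.of_equiv _ (RingHom.quotientKerEquivOfSurjective hsurj).toEquiv

end Residue

/-! ### Good reduction and bounds on periods -/

section Periods

variable {E : Type*} [Field E]

lemma isFractionRing_ringOfIntegers [CharZero E] [Algebra.IsAlgebraic ℚ E] :
    IsFractionRing (𝓞 E) E := by
  have : Algebra.IsAlgebraic ℤ E := (IsFractionRing.comap_isAlgebraic_iff (K := ℚ)).2 inferInstance
  exact IsIntegralClosure.isFractionRing_of_algebraic ℤ (𝓞 E)
    (fun x hx => by simpa using hx)

lemma isIntegrallyClosed_ringOfIntegers [CharZero E] [Algebra.IsAlgebraic ℚ E] :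
    IsIntegrallyClosed (𝓞 E) := by
  have := isFractionRing_ringOfIntegers (E := E)
  refine (isIntegrallyClosed_iff E).2 fun {x} hx => ?_
  exact ⟨⟨x, isIntegral_trans (R := ℤ) x hx⟩, rfl⟩

/-- A periodic point of a polynomial with coefficients in an integrally closed subring `R` and
leading coefficient a unit of `R` lies in `R`. -/
lemma mem_of_mem_periodicPts {R : Type*} [CommRing R] [IsDomain R] [IsIntegrallyClosed R]
    [Algebra R E] [IsFractionRing R E] (f : R[X]) (hf : 2 ≤ f.natDegree)
    (hu : IsUnit f.leadingCoeff) (x : E)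
    (hx : x ∈ Function.periodicPts (fun y => (f.map (algebraMap R E)).eval y)) :
    ∃ r : R, algebraMap R E r = x := by
  obtain ⟨n, hn, hnx⟩ := hx
  refine (isIntegrallyClosed_iff E).1 inferInstance ?_
  -- `x` is a root of `g`, whose leading coefficient is that of the iterate, a unit; dividing by it
  -- gives a monic equation.
  set g := f.comp^[n] X - X with hg
  have hlead : ∀ k, IsUnit (f.comp^[k] X).leadingCoeff := by
    intro k
    induction k with
    | zero => simp
    | succ k ih =>
      rw [Function.iterate_succ_apply', leadingCoeff_comp]
      · exact hu.mul (ih.pow _)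
      · rw [natDegree_iterate_comp, natDegree_X, mul_one]; positivity
  have hdeg : (X : R[X]).degree < (f.comp^[n] X).degree := by
    refine degree_lt_degree ?_
    rw [natDegree_iterate_comp, natDegree_X, mul_one]
    exact Nat.one_lt_pow hn.ne' (by omega)
  have hgu : IsUnit g.leadingCoeff := by
    rw [hg, leadingCoeff_sub_of_degree_lt hdeg]; exact hlead n
  obtain ⟨u, hu⟩ := hgu
  refine ⟨C ((u⁻¹ : Rˣ) : R) * g, ?_, ?_⟩
  · rw [Monic, leadingCoeff_mul, leadingCoeff_C, ← hu, Units.inv_mul]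
  · have : (fun y => (f.map (algebraMap R E)).eval y)^[n] x = x := hnx
    rw [eval₂_mul, hg, eval₂_sub, iterate_comp_eval₂, eval₂_X]
    simp only [eval_map] at this
    rw [this, sub_self, mul_zero]

/-- If the ring of integers of `E` has a finite residue field at a prime `Q` above `p` at which `f`
has good reduction, then the periods of `f` are bounded up to powers of `p`. -/
theorem exists_period_bound [CharZero E] [Algebra.IsAlgebraic ℚ E] (f : E[X]) (hf : 2 ≤ f.natDegree) (D : 𝓞 E)
    (hD : ∀ k, IsIntegral ℤ ((D : E) * f.coeff k)) (hD' : IsIntegral ℤ ((D : E) * f.leadingCoeff⁻¹))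
    {p : ℕ} (hp : p.Prime) (Q : Ideal (𝓞 E)) [hQ : Q.IsMaximal] [Finite (𝓞 E ⧸ Q)]
    (hpQ : (p : 𝓞 E) ∈ Q) (hDQ : D ∉ Q) :
    ∃ B, 0 < B ∧ ∀ x ∈ Function.periodicPts (fun y => f.eval y),
      ∃ e, (fun y => f.eval y)^[B * p ^ e] x = x := by
  have := isFractionRing_ringOfIntegers (E := E)
  have := isIntegrallyClosed_ringOfIntegers (E := E)
  -- In the local ring at `Q` the denominator `D` is invertible, so `f` is defined over `R` with
  -- unit leading coefficient.
  let R := Localization.subalgebra.ofField E Q.primeCompl Q.primeCompl_le_nonZeroDivisors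
  have hloc : IsLocalization.AtPrime R Q := Localization.subalgebra.isLocalization_ofField ..
  have : IsLocalRing R := IsLocalization.AtPrime.isLocalRing R Q
  have : IsIntegrallyClosed R :=
    isIntegrallyClosed_of_isLocalization R Q.primeCompl Q.primeCompl_le_nonZeroDivisors
  have hD0 : (D : E) ≠ 0 := by
    intro h
    exact hDQ (by rw [NumberField.RingOfIntegers.coe_eq_zero_iff.1 h]; exact Q.zero_mem)
  have hmem : ∀ z : E, IsIntegral ℤ ((D : E) * z) → z ∈ R := by
    intro z hz
    refine ⟨⟨_, hz⟩, D, hDQ, ?_⟩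
    change z = ((D : E) * z) * (D : E)⁻¹
    field_simp
  have hlift : f ∈ lifts (algebraMap R E) := by
    rw [lifts_iff_coeff_lifts]
    exact fun k => ⟨⟨_, hmem _ (hD k)⟩, rfl⟩
  obtain ⟨g, hgf, hgdeg⟩ := exists_degree_eq_of_mem_lifts hlift
  have hgnat : g.natDegree = f.natDegree := natDegree_eq_of_degree_eq hgdeg
  have hinj : Function.Injective (algebraMap R E) := IsFractionRing.injective R E
  have hlead : algebraMap R E g.leadingCoeff = f.leadingCoeff := by
    rw [← hgf, leadingCoeff_map_of_injective hinj]
  have hf0 : f.leadingCoeff ≠ 0 := by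
    rw [Ne, leadingCoeff_eq_zero]; rintro rfl; simp at hf
  have hunit : IsUnit g.leadingCoeff := by
    refine IsUnit.of_mul_eq_one ⟨_, hmem _ hD'⟩ (hinj ?_)
    rw [map_mul, hlead, map_one]
    exact mul_inv_cancel₀ hf0
  have : Finite (R ⧸ IsLocalRing.maximalIdeal R) :=
    Finite.of_equiv _ (IsLocalization.AtPrime.equivQuotMaximalIdeal Q R).toEquiv
  have hpM : (p : R) ∈ IsLocalRing.maximalIdeal R := by
    have := (IsLocalization.AtPrime.to_map_mem_maximal_iff R Q (p : 𝓞 E)).2 hpQ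
    simpa using this
  have : Nontrivial (R ⧸ IsLocalRing.maximalIdeal R) :=
    Ideal.Quotient.nontrivial_iff.2 Ideal.IsPrime.ne_top'
  have hone : 1 < Nat.card (R ⧸ IsLocalRing.maximalIdeal R) := Finite.one_lt_card
  refine ⟨_, Nat.mul_pos (Nat.factorial_pos (Nat.card (R ⧸ IsLocalRing.maximalIdeal R)))
    (Nat.sub_pos_of_lt hone), fun x hx => ?_⟩
  subst hgf
  obtain ⟨r, rfl⟩ := mem_of_mem_periodicPts g (hgnat ▸ hf) hunit x hx
  have hsemi : Function.Semiconj (algebraMap R E) (fun y => g.eval y)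
      (fun y => (g.map (algebraMap R E)).eval y) := fun y => (eval_map_apply ..).symm
  have hr : r ∈ Function.periodicPts (fun y => g.eval y) := by
    obtain ⟨n, hn, hnx⟩ := hx
    refine ⟨n, hn, hinj ?_⟩
    rw [(hsemi.iterate_right n).eq]
    exact hnx
  obtain ⟨e, he⟩ := exists_iterate_eq_of_mem_periodicPts (IsLocalRing.maximalIdeal R) hp hpM g r hr
  exact ⟨e, by rw [← (hsemi.iterate_right _).eq, he]⟩

/-- Two bounds on the periods, up to powers of two different primes, leave finitely many periodic
points. -/
theorem finite_periodicPts_of_period_bounds (f : E[X]) (hf : 2 ≤ f.natDegree)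
    {p q : ℕ} (hpq : p.Coprime q) {A B : ℕ} (hA : 0 < A) (hB : 0 < B)
    (hpA : ∀ x ∈ Function.periodicPts (fun y => f.eval y),
      ∃ e, (fun y => f.eval y)^[A * p ^ e] x = x)
    (hqB : ∀ x ∈ Function.periodicPts (fun y => f.eval y),
      ∃ e, (fun y => f.eval y)^[B * q ^ e] x = x) :
    (Function.periodicPts (fun x : E => f.eval x)).Finite := by
  set g := f.comp^[A * B] X - X with hg
  have hg0 : g ≠ 0 := by
    intro h
    have := congrArg natDegree (sub_eq_zero.1 h)
    rw [natDegree_iterate_comp, natDegree_X, mul_one] at this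
    exact (Nat.one_lt_pow (Nat.mul_pos hA hB).ne' (by omega : 1 < f.natDegree)).ne' this
  classical
  refine (g.roots.toFinset.finite_toSet).subset fun x hx => ?_
  obtain ⟨e, he⟩ := hpA x hx
  obtain ⟨e', he'⟩ := hqB x hx
  have h1 : Function.minimalPeriod (fun y => f.eval y) x ∣ A * B * p ^ e :=
    (Function.IsPeriodicPt.minimalPeriod_dvd he).trans ⟨B, by ring⟩
  have h2 : Function.minimalPeriod (fun y => f.eval y) x ∣ A * B * q ^ e' :=
    (Function.IsPeriodicPt.minimalPeriod_dvd he').trans ⟨A, by ring⟩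
  -- The gcd is `A * B`, so every periodic point is a root of the single nonzero polynomial `g`.
  have h3 := Nat.dvd_gcd h1 h2
  rw [Nat.gcd_mul_left, (hpq.pow e e').gcd_eq_one, mul_one] at h3
  have h4 : (fun y => f.eval y)^[A * B] x = x :=
    (Function.isPeriodicPt_minimalPeriod _ _).trans_dvd h3
  rw [Finset.mem_coe, Multiset.mem_toFinset, mem_roots hg0, IsRoot, hg, eval_sub,
    iterate_comp_eval, eval_X, h4, sub_self]

end Periods

/-! ### Finiteness of backward orbits over number fields -/

section BackwardOrbits

/-- Writing `g(z) = z * g₁(z) + g(0)` with `g₁` nonconstant, far out `‖g₁(z)‖ ≥ 2` and `‖z‖ ≥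
‖g(0)‖`. This keeps backward orbits bounded at each archimedean place. -/
lemma exists_norm_le_norm_eval (g : ℂ[X]) (hg : 2 ≤ g.natDegree) :
    ∃ C : ℝ, ∀ z : ℂ, C ≤ ‖z‖ → ‖z‖ ≤ ‖g.eval z‖ := by
  have hdeg : 0 < g.divX.degree := by
    rw [← natDegree_pos_iff_degree_pos, natDegree_divX_eq_natDegree_tsub_one]; omega
  have ht := g.divX.tendsto_norm_atTop hdeg tendsto_norm_cobounded_atTop
  have hev := (ht.eventually_ge_atTop 2)
  rw [← comap_norm_atTop, Filter.eventually_comap, Filter.eventually_atTop] at hev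
  obtain ⟨C, hC⟩ := hev
  refine ⟨max C ‖g.coeff 0‖, fun z hz => ?_⟩
  have h2 := hC ‖z‖ ((le_max_left _ _).trans hz) z rfl
  have h0 := (le_max_right _ _).trans hz
  have e : g.eval z = z * g.divX.eval z + g.coeff 0 := by
    have := congrArg (eval z) (divX_mul_X_add g)
    rw [eval_add, eval_mul, eval_X, eval_C] at this
    rw [← this, mul_comm]
  have h3 : ‖z * g.divX.eval z‖ ≤ ‖g.eval z‖ + ‖g.coeff 0‖ := by
    have : z * g.divX.eval z = g.eval z - g.coeff 0 := by rw [e]; ring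
    rw [this]; exact norm_sub_le _ _
  rw [norm_mul] at h3
  nlinarith [norm_nonneg z]

variable {K : Type*} [Field K]

lemma isIntegral_of_monic_of_coeff (f : K[X]) (hf : f.Monic) (hc : ∀ k, IsIntegral ℤ (f.coeff k))
    (x : K) (hx : f.eval x = 0) : IsIntegral ℤ x := by
  have hlift : f ∈ lifts (algebraMap (integralClosure ℤ K) K) := by
    rw [lifts_iff_coeff_lifts]
    exact fun k => ⟨⟨_, hc k⟩, rfl⟩
  obtain ⟨g, hgf, -, hg⟩ := lifts_and_natDegree_eq_and_monic hlift hf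
  exact isIntegral_trans (R := ℤ) (A := integralClosure ℤ K) x
    ⟨g, hg, by rw [← eval_map, hgf, hx]⟩

/-- If `D` clears the denominators of `f / f.leadingCoeff` and of `1 / f.leadingCoeff`, then it
clears the denominator of each preimage of a point whose denominator it clears. -/
lemma isIntegral_smul_of_isIntegral_smul_eval (f : K[X]) (hf : 2 ≤ f.natDegree) (D : ℤ)
    (hD : ∀ k, IsIntegral ℤ ((D : K) * (f.leadingCoeff⁻¹ * f.coeff k)))
    (hD' : IsIntegral ℤ ((D : K) * f.leadingCoeff⁻¹)) (x : K)
    (hx : IsIntegral ℤ ((D : K) * f.eval x)) : IsIntegral ℤ ((D : K) * x) := by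
  have hDi : IsIntegral ℤ (D : K) := by simpa using isIntegral_algebraMap (R := ℤ) (A := K) (x := D)
  have hf0 : f.leadingCoeff ≠ 0 := by
    rw [Ne, leadingCoeff_eq_zero]; rintro rfl; simp at hf
  have hlt : (C (f.eval x)).degree < f.degree :=
    degree_C_le.trans_lt (natDegree_pos_iff_degree_pos.1 (by omega))
  have hlead : (f - C (f.eval x)).leadingCoeff = f.leadingCoeff := leadingCoeff_sub_of_degree_lt hlt
  have hnat : (f - C (f.eval x)).natDegree = f.natDegree := natDegree_sub_C
  -- A monic polynomial with root `x`; scaling its roots by `D` gives an equation for `D * x`, the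
  -- coefficient of degree `k` gaining `D ^ (deg f - k)`.
  set h := C f.leadingCoeff⁻¹ * (f - C (f.eval x)) with hh
  have hmonic : h.Monic := by
    rw [Monic, hh, leadingCoeff_mul, leadingCoeff_C, hlead, inv_mul_cancel₀ hf0]
  have hhnat : h.natDegree = f.natDegree := by
    rw [hh, natDegree_C_mul (inv_ne_zero hf0), hnat]
  refine isIntegral_of_monic_of_coeff (h.scaleRoots (D : K)) ((monic_scaleRoots_iff _).2 hmonic)
    (fun k => ?_) _ ?_
  · rw [coeff_scaleRoots, hhnat]
    rcases lt_trichotomy k f.natDegree with hk | hk | hk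
    · rcases Nat.eq_zero_or_pos k with rfl | hk0
      · obtain ⟨d, hd⟩ := Nat.exists_eq_add_of_le hf
        -- The term with `f(x)` needs two factors `D`, one for the inverse leading coefficient and
        -- one for `f(x)`: here `deg f ≥ 2` is essential.
        have e : h.coeff 0 * (D : K) ^ (f.natDegree - 0) =
            ((D : K) * (f.leadingCoeff⁻¹ * f.coeff 0)) * D ^ (d + 1) -
              ((D : K) * f.leadingCoeff⁻¹) * ((D : K) * f.eval x) * D ^ d := by
          rw [hh, coeff_C_mul, coeff_sub, coeff_C_zero, hd]
          simp only [Nat.sub_zero, pow_add]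
          ring
        rw [e]
        exact ((hD 0).mul (hDi.pow _)).sub ((hD'.mul hx).mul (hDi.pow _))
      · obtain ⟨d, hd⟩ := Nat.exists_eq_add_of_lt hk
        have e : h.coeff k * (D : K) ^ (f.natDegree - k) =
            ((D : K) * (f.leadingCoeff⁻¹ * f.coeff k)) * D ^ d := by
          have : f.natDegree - k = d + 1 := by omega
          rw [hh, coeff_C_mul, coeff_sub, coeff_C_of_ne_zero hk0.ne', this]
          ring
        rw [e]
        exact (hD k).mul (hDi.pow _)
    · subst hk
      rw [← hhnat, hmonic.coeff_natDegree, Nat.sub_self, pow_zero, mul_one]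
      exact isIntegral_one
    · rw [coeff_eq_zero_of_natDegree_lt (hhnat ▸ hk), zero_mul]
      exact isIntegral_zero
  · have := scaleRoots_eval₂_mul (p := h) (RingHom.id K) x (D : K)
    rw [RingHom.id_apply] at this
    rw [← eval₂_id, this, eval₂_id, hh, eval_mul, eval_sub, eval_C, eval_C, sub_self, mul_zero,
      mul_zero]

/-- A backward orbit of a polynomial of degree at least two over a number field is finite. -/
theorem finite_range_of_backward_orbit [NumberField K] (f : K[X]) (hf : 2 ≤ f.natDegree)
    (x : ℕ → K) (hx : ∀ n, f.eval (x (n + 1)) = x n) : (Set.range x).Finite := by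
  classical
  have : Algebra.IsAlgebraic ℤ K := (IsFractionRing.comap_isAlgebraic_iff (K := ℚ)).2 inferInstance
  obtain ⟨D, hD0, hD⟩ := Algebra.IsAlgebraic.exists_integral_multiples ℤ
    (insert (x 0) (insert f.leadingCoeff⁻¹
      ((Finset.range (f.natDegree + 1)).image fun k => f.leadingCoeff⁻¹ * f.coeff k)))
  simp only [Algebra.smul_def, eq_intCast] at hD
  have hc : ∀ k, IsIntegral ℤ ((D : K) * (f.leadingCoeff⁻¹ * f.coeff k)) := by
    intro k
    rcases Nat.lt_or_ge k (f.natDegree + 1) with hk | hk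
    · exact hD _ (Finset.mem_insert_of_mem (Finset.mem_insert_of_mem
        (Finset.mem_image_of_mem _ (Finset.mem_range.2 hk))))
    · rw [coeff_eq_zero_of_natDegree_lt hk, mul_zero, mul_zero]; exact isIntegral_zero
  have hint : ∀ n, IsIntegral ℤ ((D : K) * x n) := by
    intro n
    induction n with
    | zero => exact hD _ (Finset.mem_insert_self _ _)
    | succ n ih =>
      exact isIntegral_smul_of_isIntegral_smul_eval f hf D hc
        (hD _ (Finset.mem_insert_of_mem (Finset.mem_insert_self _ _))) _ (by rw [hx]; exact ih)
  have hbd : ∀ φ : K →+* ℂ, ∃ B : ℝ, ∀ n, ‖φ ((D : K) * x n)‖ ≤ B := by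
    intro φ
    obtain ⟨C, hC⟩ := exists_norm_le_norm_eval (f.map φ) (by rwa [natDegree_map])
    have hn : ∀ n, ‖φ (x n)‖ ≤ max C ‖φ (x 0)‖ := by
      intro n
      induction n with
      | zero => exact le_max_right _ _
      | succ n ih =>
        rcases le_total C ‖φ (x (n + 1))‖ with h | h
        · refine (hC _ h).trans ?_
          rwa [eval_map_apply, hx]
        · exact h.trans (le_max_left _ _)
    refine ⟨‖φ D‖ * max C ‖φ (x 0)‖, fun n => ?_⟩
    rw [map_mul, norm_mul]
    exact mul_le_mul_of_nonneg_left (hn n) (norm_nonneg _)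
  choose B hB using hbd
  obtain ⟨B', hB'⟩ := (Set.finite_range B).bddAbove
  -- Northcott: finitely many integers of `K` have all conjugates bounded by `B'`.
  have hfin := NumberField.Embeddings.finite_of_norm_le K ℂ B'
  refine Set.Finite.of_finite_image (f := fun y => (D : K) * y) (hfin.subset ?_) ?_
  · rintro _ ⟨_, ⟨n, rfl⟩, rfl⟩
    exact ⟨hint n, fun φ => (hB φ n).trans (hB' ⟨φ, rfl⟩)⟩
  · exact (mul_right_injective₀ (by exact_mod_cast hD0)).injOn

/-- In an extension of prime degree `ℓ`, polynomials of degree less than `ℓ` over the base do not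
take values in the base outside it. -/
lemma mem_range_of_eval_mem_range {k L : Type*} [Field k] [Field L] [Algebra k L]
    (hl : (Module.finrank k L).Prime) (f : k[X]) (hf0 : 0 < f.natDegree)
    (hf : f.natDegree < Module.finrank k L) (y : L) (c : k) (hy : aeval y f = algebraMap k L c) :
    y ∈ (algebraMap k L).range := by
  have : FiniteDimensional k L := Module.finite_of_finrank_pos hl.pos
  -- The minimal polynomial has degree 1 or `ℓ`, and it divides `f - c`, of degree below `ℓ`.
  have hdvd := minpoly.degree_dvd (K := k) (x := y) (Algebra.IsIntegral.isIntegral y)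
  rcases (Nat.dvd_prime hl).1 hdvd with h | h
  · exact minpoly.natDegree_eq_one_iff.1 h
  · exfalso
    have hne : f - C c ≠ 0 := by
      intro h0
      rw [sub_eq_zero.1 h0, natDegree_C] at hf0
      exact hf0.false
    have := natDegree_le_of_dvd (minpoly.dvd k y (p := f - C c) (by simp [hy])) hne
    rw [natDegree_sub_C] at this
    omega

end BackwardOrbits

/-! ### The tower: deducing (P) and (P2) -/

section Towers

lemma exists_forall_lt_of_injOn (p : ℕ → ℕ) (hp : Set.InjOn p (Set.Ici 1)) (N : ℕ) :
    ∃ m, ∀ n, m < n → N < p n := by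
  have hfin : {n | n ∈ Set.Ici 1 ∧ p n ∈ Set.Iic N}.Finite :=
    Set.Finite.of_finite_image ((Set.finite_Iic N).subset (by rintro _ ⟨n, hn, rfl⟩; exact hn.2))
      (hp.mono fun n hn => hn.1)
  obtain ⟨m, hm⟩ := hfin.bddAbove
  refine ⟨m, fun n hn => ?_⟩
  by_contra! h
  exact hn.not_ge (hm ⟨by simp; omega, h⟩)

variable {Ω : Type*} [Field Ω]

/-- In a tower of extensions of prime degrees larger than `f.natDegree`, all preimages under `f`
of points of the base lie in the base. -/
lemma mem_of_eval_mem_of_prime_degrees (K : ℕ → Subfield Ω) (hK : Monotone K) (f : Polynomial Ω)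
    (hf : 0 < f.natDegree) (m : ℕ) (hfm : ∀ k, f.coeff k ∈ K m)
    (hdeg : ∀ n, m ≤ n →
      letI : Algebra (K n) (K (n + 1)) := (Subfield.inclusion (hK (Nat.le_succ n))).toAlgebra
      (Module.finrank (K n) (K (n + 1))).Prime ∧ f.natDegree < Module.finrank (K n) (K (n + 1)))
    (y : Ω) (hy : f.eval y ∈ K m) (d : ℕ) (hyd : y ∈ K (m + d)) : y ∈ K m := by
  induction d with
  | zero => exact hyd
  | succ d ih =>
    refine ih ?_
    have hmd : K m ≤ K (m + d) := hK (Nat.le_add_right m d)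
    let : Algebra (K (m + d)) (K (m + d + 1)) :=
      (Subfield.inclusion (hK (Nat.le_succ (m + d)))).toAlgebra
    obtain ⟨hprime, hlt⟩ := hdeg (m + d) (Nat.le_add_right m d)
    have hlift : f ∈ lifts (K (m + d)).subtype := by
      rw [lifts_iff_coeff_lifts]
      exact fun k => ⟨⟨_, hmd (hfm k)⟩, rfl⟩
    obtain ⟨g, rfl⟩ := hlift
    simp only [coe_mapRingHom, natDegree_map] at hf hlt hy
    obtain ⟨c, hc⟩ := mem_range_of_eval_mem_range hprime g hf hlt ⟨y, hyd⟩ ⟨_, hmd hy⟩ (by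
      refine (K (m + d + 1)).subtype_injective ?_
      rw [aeval_def, hom_eval₂]
      exact eval₂_eq_eval_map _)
    have : (c : Ω) = y := congrArg (K (m + d + 1)).subtype hc
    exact this ▸ c.2

lemma exists_coeff_mem (K : ℕ → Subfield Ω) (hK : Monotone K) (F : Subfield Ω)
    (hF : (F : Set Ω) = ⋃ n, (K n : Set Ω))
    (f : F[X]) : ∃ m, ∀ n, m ≤ n → ∀ k, ((f.coeff k : F) : Ω) ∈ K n := by
  have h : ∀ k, ∃ n, ((f.coeff k : F) : Ω) ∈ K n := fun k => by
    have := (f.coeff k).2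
    rw [← SetLike.mem_coe, hF] at this
    exact Set.mem_iUnion.1 this
  choose N hN using h
  refine ⟨(Finset.range (f.natDegree + 1)).sup N, fun n hn k => ?_⟩
  rcases Nat.lt_or_ge k (f.natDegree + 1) with hk | hk
  · exact hK ((Finset.le_sup (Finset.mem_range.2 hk)).trans hn) (hN k)
  · rw [coeff_eq_zero_of_natDegree_lt hk]; exact (K n).zero_mem

/-- Property (P) from (P2), for a union of a tower of number fields of prime degrees tending to
infinity. -/
theorem propertyP_of_propertyP2 (K : ℕ → Subfield Ω) (hK : Monotone K) (F : Subfield Ω)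
    (hF : (F : Set Ω) = ⋃ n, (K n : Set Ω))
    [∀ n, NumberField (K n)] (p : ℕ → ℕ)
    (hp : ∀ n, 1 ≤ n → (p n).Prime) (hp_inj : Set.InjOn p (Set.Ici 1))
    (hdeg : ∀ n,
      letI : Algebra (K n) (K (n + 1)) := (Subfield.inclusion (hK (Nat.le_succ n))).toAlgebra
      Module.finrank (K n) (K (n + 1)) = p (n + 1))
    (hP2 : PropertyP2 F) : PropertyP F := by
  rintro f hf ⟨X, hXinf, hX⟩
  obtain ⟨x₀, hx₀X, hx₀⟩ := (hXinf.sdiff (hP2 f hf)).nonempty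
  have hpre : ∀ x : X, ∃ y : X, f.eval (y : F) = x := by
    rintro ⟨x, hx⟩
    rw [← hX] at hx
    obtain ⟨y, hy, hyx⟩ := hx
    exact ⟨⟨y, hy⟩, hyx⟩
  choose g hg using hpre
  set x : ℕ → F := fun n => (g^[n] ⟨x₀, hx₀X⟩ : X) with hx
  have hxs : ∀ n, f.eval (x (n + 1)) = x n := fun n => by
    simp only [hx, Function.iterate_succ_apply', hg]
  obtain ⟨m₁, hm₁⟩ := exists_coeff_mem K hK F hF f
  obtain ⟨m₂, hm₂⟩ := exists_forall_lt_of_injOn p hp_inj f.natDegree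
  have hunion : ∀ y : F, ∃ n, (y : Ω) ∈ K n := fun y => by
    have := y.2
    rw [← SetLike.mem_coe, hF] at this
    exact Set.mem_iUnion.1 this
  obtain ⟨m₃, hm₃⟩ := hunion x₀
  -- From level `m` on, the coefficients of `f` and the point `x₀` are available and the degrees
  -- exceed `deg f`.
  set m := max m₁ (max m₂ m₃) with hm
  have hxm : ∀ n, (x n : Ω) ∈ K m := by
    intro n
    induction n with
    | zero => exact hK (by omega) hm₃
    | succ n ih =>
      obtain ⟨d, hd⟩ := hunion (x (n + 1))
      refine mem_of_eval_mem_of_prime_degrees K hK (f.map F.subtype) (by rw [natDegree_map]; omega)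
        m (fun k => by rw [coeff_map]; exact hm₁ m (by omega) k) (fun j hj => ?_) _ ?_ d
        (hK (Nat.le_add_left d m) hd)
      · rw [hdeg j, natDegree_map]
        exact ⟨hp _ (by omega), hm₂ _ (by omega)⟩
      · have := eval_map_apply (f := F.subtype) (p := f) (x (n + 1))
        rw [hxs] at this
        exact this ▸ ih
  have hlift : f.map F.subtype ∈ lifts (K m).subtype := by
    rw [lifts_iff_coeff_lifts]
    exact fun k => ⟨⟨_, hm₁ m (by omega) k⟩, by rw [coeff_map]; rfl⟩
  obtain ⟨f', hf'⟩ := hlift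
  rw [coe_mapRingHom] at hf'
  have hfin := finite_range_of_backward_orbit f'
    (by rw [← natDegree_map (K m).subtype, hf', natDegree_map]; exact hf)
    (fun n => (⟨x n, hxm n⟩ : K m)) (fun n => by
      refine (K m).subtype_injective ?_
      rw [← eval_map_apply, hf']
      exact (eval_map_apply (f := F.subtype) (p := f) (x (n + 1))).trans (congrArg _ (hxs n)))
  have hninj : ¬ Function.Injective x := fun hinj =>
    (Set.infinite_range_of_injective (f := fun n => (⟨x n, hxm n⟩ : K m))
      (fun a b hab => hinj (Subtype.ext (congrArg (K m).subtype hab)))) hfin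
  have hiter : ∀ i j, (fun y => f.eval y)^[j] (x (i + j)) = x i := by
    intro i j
    induction j with
    | zero => rfl
    | succ j ih => rw [Function.iterate_succ_apply, ← add_assoc, hxs, ih]
  -- A repetition makes `x i` periodic, and `f^[i]` carries it to `x₀`, which is not.
  have hperiodic : ∀ i j, i < j → x i ≠ x j := by
    intro i j hij he
    refine hx₀ ⟨j - i, Nat.sub_pos_of_lt hij, ?_⟩
    have h1 : (fun y => f.eval y)^[j - i] (x i) = x i := by
      conv_lhs => rw [he]
      have := hiter i (j - i)
      rwa [Nat.add_sub_cancel' hij.le] at this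
    have h0 : (fun y => f.eval y)^[i] (x i) = x₀ := by
      have := hiter 0 i
      rwa [zero_add] at this
    change (fun y => f.eval y)^[j - i] x₀ = x₀
    rw [← h0, ← Function.iterate_add_apply, add_comm, Function.iterate_add_apply, h1]
  refine hninj fun i j he => ?_
  rcases lt_trichotomy i j with h | h | h
  · exact absurd he (hperiodic i j h)
  · exact h
  · exact absurd he.symm (hperiodic j i h)

/-- Property (P2) for a union of a tower of number fields in which infinitely many rational primes
are eventually totally ramified. -/
theorem propertyP2_of_isTotallyRamifiedAbove [CharZero Ω] [Algebra.IsAlgebraic ℚ Ω]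
    (K : ℕ → Subfield Ω) (hK : Monotone K) (F : Subfield Ω)
    (hF : (F : Set Ω) = ⋃ n, (K n : Set Ω))
    [∀ n, NumberField (K n)] (p : ℕ → ℕ)
    (hp : ∀ n, 1 ≤ n → (p n).Prime) (hp_inj : Set.InjOn p (Set.Ici 1))
    (hram : ∀ n,
      letI : Algebra (K n) (K (n + 1)) := (Subfield.inclusion (hK (Nat.le_succ n))).toAlgebra
      ∀ i, 1 ≤ i → i ≤ n + 1 → IsTotallyRamifiedAbove (K n) (K (n + 1)) (p i)) :
    PropertyP2 F := by
  classical
  intro f hf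
  have : Algebra.IsAlgebraic ℚ F :=
    Algebra.IsAlgebraic.of_injective (F.subtype.toRatAlgHom) F.subtype_injective
  have : Algebra.IsAlgebraic ℤ F := (IsFractionRing.comap_isAlgebraic_iff (K := ℚ)).2 inferInstance
  obtain ⟨D, hD0, hD⟩ := Algebra.IsAlgebraic.exists_integral_multiples ℤ
    (insert f.leadingCoeff⁻¹ ((Finset.range (f.natDegree + 1)).image f.coeff))
  simp only [Algebra.smul_def, eq_intCast] at hD
  have hc : ∀ k, IsIntegral ℤ ((D : F) * f.coeff k) := by
    intro k
    rcases Nat.lt_or_ge k (f.natDegree + 1) with hk | hk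
    · exact hD _ (Finset.mem_insert_of_mem (Finset.mem_image_of_mem _ (Finset.mem_range.2 hk)))
    · rw [coeff_eq_zero_of_natDegree_lt hk, mul_zero]; exact isIntegral_zero
  -- Beyond `m`, `p i > |D|`, so `p i` does not divide `D` and the reduction of `f` above `p i` is
  -- good.
  obtain ⟨m, hm⟩ := exists_forall_lt_of_injOn p hp_inj D.natAbs
  have hbound : ∀ i, m < i → ∃ B, 0 < B ∧ ∀ x ∈ Function.periodicPts (fun y => f.eval y),
      ∃ e, (fun y => f.eval y)^[B * p i ^ e] x = x := by
    intro i hi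
    have hpi := hp i (by omega)
    have hmax : (Ideal.span {(p i : ℤ)}).IsMaximal :=
      PrincipalIdealRing.isMaximal_of_irreducible (Nat.prime_iff_prime_int.1 hpi).irreducible
    have : IsFractionRing (𝓞 F) F := isFractionRing_ringOfIntegers
    obtain ⟨Q, hQ, hQp⟩ := Ideal.exists_ideal_over_prime_of_isIntegral_of_isDomain
      (S := 𝓞 F) (Ideal.span {(p i : ℤ)})
      (by rw [(RingHom.injective_iff_ker_eq_bot _).1 (algebraMap ℤ (𝓞 F)).injective_int]
          exact bot_le)
    have hmem : ∀ z : ℤ, (z : 𝓞 F) ∈ Q ↔ (p i : ℤ) ∣ z := by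
      intro z
      rw [← Ideal.mem_span_singleton, ← hQp, Ideal.mem_comap, eq_intCast]
    have hQmax : Q.IsMaximal :=
      Ideal.isMaximal_of_isIntegral_of_isMaximal_comap (R := ℤ) Q (hQp ▸ hmax)
    have hpQ : (p i : 𝓞 F) ∈ Q := by simpa using (hmem (p i)).2 dvd_rfl
    have : Finite (𝓞 F ⧸ Q) := finite_quotient_of_isTotallyRamifiedAbove K hK hpi i
      (fun n hn => hram n i (by omega) (by omega)) F hF Q hpQ
    refine exists_period_bound f hf (D : 𝓞 F) (by simpa using hc)
      (by simpa using hD _ (Finset.mem_insert_self _ _)) hpi Q hpQ ?_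
    rw [hmem, Int.natCast_dvd]
    exact fun h => (Nat.le_of_dvd (Int.natAbs_pos.2 hD0) h).not_gt (hm i hi)
  obtain ⟨A, hA, hA'⟩ := hbound (m + 1) (by omega)
  obtain ⟨B, hB, hB'⟩ := hbound (m + 2) (by omega)
  refine finite_periodicPts_of_period_bounds f hf ?_ hA hB hA' hB'
  refine (Nat.coprime_primes (hp _ (by omega)) (hp _ (by omega))).2 fun h => ?_
  have := hp_inj (by simp) (by simp) h
  omega

end Towers

theorem corollary2p2
    (p : ℕ → ℕ) (hp : ∀ n, 1 ≤ n → (p n).Prime) (hp_inj : Set.InjOn p (Set.Ici 1))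
    (K : ℕ → Subfield (AlgebraicClosure ℚ)) (hK_nf : ∀ n, NumberField (K n)) (hK : Monotone K)
    (hK_ram : ∀ n,
      letI : Algebra (K n) (K (n + 1)) := (Subfield.inclusion (hK (Nat.le_succ n))).toAlgebra
      ∀ i, 1 ≤ i → i ≤ n + 1 → IsTotallyRamifiedAbove (K n) (K (n + 1)) (p i))
    (F : Subfield (AlgebraicClosure ℚ)) (hF : (F : Set (AlgebraicClosure ℚ)) = ⋃ n, (K n : Set (AlgebraicClosure ℚ))) :
    PropertyP2 F ∧
      ((∀ n,
        letI : Algebra (K n) (K (n + 1)) := (Subfield.inclusion (hK (Nat.le_succ n))).toAlgebra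
        Module.finrank (K n) (K (n + 1)) = p (n + 1)) → PropertyP F) := by
  have : Algebra.IsAlgebraic ℚ (AlgebraicClosure ℚ) :=
    AlgebraicClosure.isAlgebraic ℚ
  have hP2 := propertyP2_of_isTotallyRamifiedAbove K hK F hF p hp hp_inj hK_ram
  exact ⟨hP2, fun hdeg => propertyP_of_propertyP2 K hK F hF p hp hp_inj hdeg hP2⟩
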